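/- For $l,m\in\mathbb{N}$, let $SK_{1,l}$ be the subdivided star obtained from $l$ copies of the path $P_3$ by identifying one pendant vertex of each copy to a single vertex, the coalescence vertex (for $l=0$ it is this vertex alone). Let $T_{l,m}$ be the graph obtained from the disjoint union of $SK_{1,l}$ and $SK_{1,m}$ by joining their coalescence vertices by an edge. For a finite simple graph $G$ with adjacency matrix $A$, let $U(t)=\exp(\mathrm{i}tA)$ for $t\in\mathbb{R}$, and let $\mathbf{e}_v$ denote the characteristic vector of a vertex $v$. **Theorem.** For every natural number $l$, there is pretty good state transfer in $T_{l,l}$ between its two coalescence vertices $a\ne b$ with respect to a sequence in $(4\mathbb{Z}-1)\frac{\pi}{2}$. That is, there are a sequence $(\tau_k)$ of real numbers, each of the form $(4q-1)\frac{\pi}{2}$ with $q\in\mathbb{Z}$, and a number $\gamma\in\mathbb{C}$ such that $$\lim_{k\to\infty}U(\tau_k)\,\mathbf{e}_a=\gamma\,\mathbf{e}_b .$$ -/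

import Mathlib

open Filter Topology

/-- The subdivided star with `l` branches: `l` copies of the path on three vertices, with one
pendant vertex of each copy identified to a single coalescence vertex `none`. In the branch `i`,
the vertex `some (i, 0)` is the middle vertex of the path and `some (i, 1)` is the remaining
pendant vertex. -/
def subdividedStar (l : ℕ) : SimpleGraph (Option (Fin l × Fin 2)) :=
  SimpleGraph.fromRel fun u v =>
    (u = none ∧ ∃ i, v = some (i, 0)) ∨ ∃ i, u = some (i, 0) ∧ v = some (i, 1)

/-- The vertices of the double subdivided star: those of the two subdivided stars. -/
abbrev DoubleStarVertex (l m : ℕ) : Type :=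
  Option (Fin l × Fin 2) ⊕ Option (Fin m × Fin 2)

/-- The coalescence vertex of the first subdivided star. -/
def coalescenceLeft (l m : ℕ) : DoubleStarVertex l m := Sum.inl none

/-- The coalescence vertex of the second subdivided star. -/
def coalescenceRight (l m : ℕ) : DoubleStarVertex l m := Sum.inr none

/-- The double subdivided star `T_{l,m}`: the disjoint union of two subdivided stars, with an
additional edge joining their coalescence vertices. -/
def doubleSubdividedStar (l m : ℕ) : SimpleGraph (DoubleStarVertex l m) :=
  (subdividedStar l).sum (subdividedStar m) ⊔
    SimpleGraph.edge (coalescenceLeft l m) (coalescenceRight l m)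

open Classical in
/-- The transition matrix `U(t) = exp(itA)`, where `A` is the adjacency matrix of `G`. -/
noncomputable def transitionMatrix {V : Type*} [Fintype V] [DecidableEq V]
    (G : SimpleGraph V) (t : ℝ) : Matrix V V ℂ :=
  NormedSpace.exp ((Complex.I * (t : ℂ)) • G.adjMatrix ℂ)

/-- Pretty good state transfer in `G` between the distinct vertices `a` and `b`, with respect to
a sequence of times in `S`. -/
def PrettyGoodStateTransferIn {V : Type*} [Fintype V] [DecidableEq V]
    (G : SimpleGraph V) (a b : V) (S : Set ℝ) : Prop :=
  a ≠ b ∧ ∃ (τ : ℕ → ℝ) (γ : ℂ), (∀ k, τ k ∈ S) ∧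
    Tendsto (fun k => (transitionMatrix G (τ k)).mulVec (Pi.single a 1)) atTop
      (𝓝 (γ • Pi.single b (1 : ℂ)))

/-!
The vector `e_a + e_b` lies in the space of vectors that are constant on the cells of an equitable
partition of `T_{l,l}`, where the adjacency matrix acts with characteristic polynomial
`X ^ 3 - X ^ 2 - (l + 1) X + 1`. Hence only the roots `x, y, z` of this cubic govern the evolution
of `e_a + e_b`. The graph is bipartite with `a` and `b` in different classes, so conjugation by the
diagonal sign matrix reverses time and turns `e_a + e_b` into `± (e_a - e_b)`. Thus, if the phases
`exp (i τ x)`, `exp (i τ y)`, `exp (i τ z)` all approach `γ` with `γ ^ 2 = -1`, then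
`U(τ) (e_a + e_b)` approaches `γ (e_a + e_b)` while `U(τ) (e_a - e_b)` approaches
`-γ (e_a - e_b)`, and averaging gives `U(τ) e_a → γ e_b`.

For `l ≠ 0` the cubic is irreducible. If two distinct roots satisfied `y = r + s x` with `r, s`
rational, then taking traces would shift the relation to `y - m = s (x - m)` with `m` the mean of
the roots, and taking norms would give `s ^ 3 = 1`, so `s = 1` and `y = x`. Therefore `1, x, y` are
linearly independent over `ℚ`, and Kronecker's theorem (through Weyl equidistribution) brings
`exp (i τ x)` and `exp (i τ y)` to `i` along times `τ` with `exp (i τ) = -i`. Since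
`x + y + z = 1`, the third phase is then forced to approach `-i / (i * i) = i`. For `l = 0` the
graph is a single edge and `e_a + e_b` is an eigenvector with eigenvalue `1`.
-/

section Equidistribution

open MeasureTheory UnitAddTorus

theorem tendsto_birkhoffAverage_zero_of_comp_eq_mul {α : Type*} {f : α → α} {g : α → ℂ} {c : ℂ}
    (hc : c ≠ 1) (hg : ∀ y, g (f y) = c * g y) (hb : Bornology.IsBounded (Set.range g)) (y : α) :
    Tendsto (birkhoffAverage ℂ f g · y) atTop (𝓝 0) := by
  have hiter : ∀ k, g (f^[k] (f y)) = c * g (f^[k] y) := fun k => by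
    rw [← Function.iterate_succ_apply, Function.iterate_succ_apply', hg]
  have havg : ∀ N, birkhoffAverage ℂ f g N (f y) = c * birkhoffAverage ℂ f g N y := fun N => by
    simp only [birkhoffAverage, birkhoffSum, hiter, ← Finset.mul_sum, smul_eq_mul, mul_left_comm]
  have h := (tendsto_birkhoffAverage_apply_sub_birkhoffAverage' ℂ hb f y).const_mul (c - 1)⁻¹
  rw [mul_zero] at h
  refine h.congr fun N => ?_
  rw [havg, ← sub_one_mul, inv_mul_cancel_left₀ (sub_ne_zero.2 hc)]

theorem isClosed_setOf_tendsto_birkhoffAverage_continuousMap {X : Type*} [TopologicalSpace X]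
    [CompactSpace X] (f : C(X, X)) (x : X) {L : C(X, ℂ) → ℂ} (hL : Continuous L) :
    IsClosed {φ : C(X, ℂ) | Tendsto (birkhoffAverage ℂ f φ · x) atTop (𝓝 (L φ))} := by
  have hT : LipschitzWith 1 fun φ : C(X, ℂ) => φ.comp f := LipschitzWith.of_dist_le_mul
    fun φ ψ => by
      simpa using (ContinuousMap.dist_le dist_nonneg).2 fun z =>
        ContinuousMap.dist_apply_le_dist (f := φ) (g := ψ) (f z)
  have heval : UniformContinuous fun φ : C(X, ℂ) => φ x :=
    (LipschitzWith.of_dist_le_mul (K := 1) fun φ ψ => by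
      simpa using ContinuousMap.dist_apply_le_dist x).uniformContinuous
  have hiter : ∀ k (φ : C(X, ℂ)), ((·.comp f)^[k] φ) x = φ (f^[k] x) := by
    intro k
    induction k with
    | zero => exact fun _ => rfl
    | succ k ih =>
      exact fun φ => by
        rw [Function.iterate_succ_apply, ih, Function.iterate_succ_apply', ContinuousMap.comp_apply]
  simpa only [birkhoffAverage, birkhoffSum, hiter] using
    isClosed_setOfPred_tendsto_birkhoffAverage ℂ hT heval hL

theorem integral_eq_zero_of_add_left_eq_mul {G : Type*} [MeasurableSpace G] [AddGroup G]
    [MeasurableAdd G] {μ : Measure G} [μ.IsAddLeftInvariant] {g : G → ℂ} {x : G} {c : ℂ}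
    (hc : c ≠ 1) (hg : ∀ y, g (x + y) = c * g y) : ∫ y, g y ∂μ = 0 := by
  have h : c * ∫ y, g y ∂μ = ∫ y, g y ∂μ := by
    rw [← integral_const_mul, ← integral_add_left_eq_self g x]
    simp only [hg]
  exact (mul_left_eq_self₀.1 h).resolve_left hc

variable {d : Type*} [Fintype d]

theorem mFourier_apply_add (n : d → ℤ) (x y : UnitAddTorus d) :
    mFourier n (x + y) = mFourier n x * mFourier n y := by
  simp [mFourier, fourier_apply, smul_add, AddCircle.toCircle_add, Finset.prod_mul_distrib]

theorem mFourier_coe (n : d → ℤ) (α : d → ℝ) :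
    mFourier n (fun i => (α i : UnitAddCircle)) =
      Complex.exp (2 * Real.pi * Complex.I * ∑ i, n i * α i) := by
  simp [mFourier, ← Complex.exp_sum, Finset.mul_sum, mul_assoc]

theorem tendsto_birkhoffAverage_mFourier {μ : Measure (UnitAddTorus d)} [μ.IsAddLeftInvariant]
    [IsProbabilityMeasure μ] {x : UnitAddTorus d} {n : d → ℤ} (hx : n ≠ 0 → mFourier n x ≠ 1)
    (y : UnitAddTorus d) :
    Tendsto (birkhoffAverage ℂ (x + ·) (mFourier n) · y) atTop (𝓝 (∫ z, mFourier n z ∂μ)) := by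
  rcases eq_or_ne n 0 with rfl | hn
  · refine tendsto_const_nhds.congr' ?_
    filter_upwards [eventually_ne_atTop 0] with N hN
    simp [birkhoffAverage, birkhoffSum, mFourier_zero, hN]
  · have hmul : ∀ y, mFourier n (x + y) = mFourier n x * mFourier n y := mFourier_apply_add n x
    rw [integral_eq_zero_of_add_left_eq_mul (hx hn) hmul]
    exact tendsto_birkhoffAverage_zero_of_comp_eq_mul (hx hn) hmul
      (isCompact_range (mFourier n).continuous).isBounded y

/-- **Weyl's equidistribution theorem** -/
theorem tendsto_birkhoffAverage_integral {μ : Measure (UnitAddTorus d)} [μ.IsAddLeftInvariant]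
    [IsProbabilityMeasure μ] {x : UnitAddTorus d} (hx : ∀ n ≠ 0, mFourier n x ≠ 1)
    (φ : C(UnitAddTorus d, ℂ)) (y : UnitAddTorus d) :
    Tendsto (birkhoffAverage ℂ (x + ·) φ · y) atTop (𝓝 (∫ z, φ z ∂μ)) := by
  have hint (φ : C(UnitAddTorus d, ℂ)) : Integrable φ μ :=
    φ.continuous.integrable_of_hasCompactSupport (.of_compactSpace φ)
  have hcont : Continuous fun φ : C(UnitAddTorus d, ℂ) => ∫ z, φ z ∂μ := by
    refine (LipschitzWith.of_dist_le_mul (K := 1) fun φ ψ => ?_).continuous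
    rw [dist_eq_norm, ← integral_sub (hint φ) (hint ψ)]
    simpa [dist_eq_norm] using
      norm_integral_le_of_norm_le_const (μ := μ) (.of_forall (φ - ψ).norm_coe_le_norm)
  have hspan : ∀ ψ ∈ Submodule.span ℂ (Set.range (mFourier (d := d))),
      Tendsto (birkhoffAverage ℂ (x + ·) ψ · y) atTop (𝓝 (∫ z, ψ z ∂μ)) := by
    intro ψ hψ
    induction hψ using Submodule.span_induction with
    | mem ψ hψ =>
      obtain ⟨n, rfl⟩ := hψ
      exact tendsto_birkhoffAverage_mFourier (hx n) y
    | zero => simp [birkhoffAverage, birkhoffSum]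
    | add ψ χ _ _ hψ hχ =>
      simpa [birkhoffAverage_add, integral_add (hint ψ) (hint χ)] using hψ.add hχ
    | smul c ψ _ hψ =>
      simpa [birkhoffAverage, birkhoffSum, ← Finset.mul_sum, mul_left_comm, integral_const_mul]
        using hψ.const_mul c
  refine closure_minimal hspan
    (isClosed_setOf_tendsto_birkhoffAverage_continuousMap (.addLeft x) y hcont) ?_
  rw [← Submodule.topologicalClosure_coe, span_mFourier_closure_eq_top]
  trivial

theorem denseRange_nsmul_of_mFourier_ne_one {x : UnitAddTorus d}
    (hx : ∀ n ≠ 0, mFourier n x ≠ 1) :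
    DenseRange fun q : ℕ => q • x := by
  have : IsProbabilityMeasure (volume : Measure UnitAddCircle) := ⟨by simp⟩
  by_contra hdense
  set H := closure (Set.range fun q : ℕ => q • x)
  obtain ⟨y, hy⟩ : ∃ y, y ∉ H := by simpa [DenseRange, Dense] using hdense
  have hH (q : ℕ) : q • x ∈ H := subset_closure ⟨q, rfl⟩
  let δ : C(UnitAddTorus d, ℝ) := ⟨(Metric.infDist · H), Metric.continuous_infDist_pt H⟩
  have hδ_orbit (q : ℕ) : δ (q • x) = 0 := Metric.infDist_zero_of_mem (hH q)
  have hδ_int : ∫ z, δ z = 0 := by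
    have hmean : Tendsto (fun _ : ℕ => (0 : ℂ)) atTop (𝓝 (∫ z, (δ z : ℂ))) :=
      (tendsto_birkhoffAverage_integral hx ((⟨_, Complex.continuous_ofReal⟩ : C(ℝ, ℂ)).comp δ)
        0).congr fun N => by simp [birkhoffAverage, birkhoffSum, add_left_iterate, hδ_orbit]
    simpa [integral_complex_ofReal] using tendsto_nhds_unique hmean tendsto_const_nhds
  have hδ_pos : 0 < ∫ z, δ z :=
    δ.continuous.integral_pos_of_hasCompactSupport_nonneg_nonzero (.of_compactSpace δ)
      (fun _ => Metric.infDist_nonneg)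
      ((isClosed_closure.notMem_iff_infDist_pos ⟨0 • x, hH 0⟩).1 hy).ne'
  exact hδ_pos.ne' hδ_int

/-- **Kronecker's approximation theorem** -/
theorem denseRange_nsmul_of_linearIndependent {n : ℕ} {α : Fin n → ℝ}
    (hα : LinearIndependent ℚ (Fin.cons 1 α : Fin (n + 1) → ℝ)) :
    DenseRange fun q : ℕ => q • fun i => (α i : UnitAddCircle) := by
  refine denseRange_nsmul_of_mFourier_ne_one fun m hm h => hm ?_
  rw [mFourier_coe, Complex.exp_eq_one_iff] at h
  obtain ⟨k, hk⟩ := h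
  have hrel : (-k : ℝ) + ∑ i, m i * α i = 0 := by
    have := mul_left_cancel₀ Complex.two_pi_I_ne_zero (hk.trans (mul_comm _ _))
    rw [neg_add_eq_zero]
    exact_mod_cast this.symm
  funext i
  simpa using Fintype.linearIndependent_iff.1 hα (Fin.cons (-k) fun i => m i)
    (by simpa [Fin.sum_univ_succ, Rat.smul_def] using hrel) i.succ

theorem exists_seq_tendsto_exp_of_linearIndependent {n : ℕ} {α : Fin n → ℝ}
    (hα : LinearIndependent ℚ (Fin.cons 1 α : Fin (n + 1) → ℝ)) (θ : Fin n → ℝ) :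
    ∃ q : ℕ → ℕ, ∀ i, Tendsto (fun k => Complex.exp (2 * Real.pi * Complex.I * (q k * α i))) atTop
      (𝓝 (Complex.exp (2 * Real.pi * Complex.I * θ i))) := by
  have hdense := denseRange_nsmul_of_linearIndependent hα fun i => (θ i : UnitAddCircle)
  obtain ⟨v, hv, hlim⟩ := mem_closure_iff_seq_limit.1 hdense
  choose q hq using hv
  refine ⟨q, fun i => ?_⟩
  have h := ((fourier 1).continuous.tendsto _).comp (tendsto_pi_nhds.1 hlim i)
  simpa only [fourier_coe_apply, Function.comp_def, ← hq, Pi.smul_apply, ← AddCircle.coe_nsmul,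
    Int.cast_one, mul_one, Complex.ofReal_one, div_one, nsmul_eq_mul, Complex.ofReal_mul,
    Complex.ofReal_natCast] using h

end Equidistribution

section OddDegree

variable {K : Type*} [Field K] [LinearOrder K] [IsStrictOrderedRing K]

theorem algEquiv_apply_eq_self_of_eq_add_mul {E : Type*} [Field E] [Algebra K E]
    [FiniteDimensional K E] (hodd : Odd (Module.finrank K E)) (σ : E ≃ₐ[K] E) {a : E} {r s : K}
    (h : σ a = algebraMap K E r + algebraMap K E s * a) : σ a = a := by
  by_cases ha : a ∈ Set.range (algebraMap K E)
  · obtain ⟨c, rfl⟩ := ha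
    exact σ.commutes c
  set d := Module.finrank K E
  have hd : (d : K) ≠ 0 := Nat.cast_ne_zero.2 hodd.pos.ne'
  have htrace : (d : K) * r + s * Algebra.trace K E a = Algebra.trace K E a := by
    have := Algebra.trace_eq_of_algEquiv σ a
    rw [h, map_add, ← Algebra.smul_def, map_smul, Algebra.trace_algebraMap] at this
    simpa using this
  -- The affine map `t ↦ r + s * t` permutes the conjugates of `a`, so it fixes their mean `m`.
  set m : K := Algebra.trace K E a / d
  have hm : r + s * m = m := by
    simp only [m]
    field_simp
    linear_combination htrace
  have hσ : σ (a - algebraMap K E m) = algebraMap K E s * (a - algebraMap K E m) := by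
    rw [map_sub, h, σ.commutes]
    nth_rw 1 [← hm]
    simp only [map_add, map_mul]
    ring
  have hb : a - algebraMap K E m ≠ 0 := fun hb => ha ⟨m, (sub_eq_zero.1 hb).symm⟩
  have hnorm : s ^ d = 1 := by
    have := Algebra.norm_eq_of_algEquiv σ (a - algebraMap K E m)
    rw [hσ, map_mul, Algebra.norm_algebraMap] at this
    exact (mul_eq_right₀ (Algebra.norm_ne_zero_iff.2 hb)).1 this
  have hs : s = 1 := hodd.strictMono_pow.injective (by simpa using hnorm)
  rw [hs, map_one, one_mul, map_sub, σ.commutes] at hσ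
  exact sub_left_injective hσ

open Polynomial

variable {L : Type*} [Field L] [Algebra K L] {p : K[X]} {x y : L}

theorem eq_of_aeval_eq_zero_of_eq_add_mul (hp : Irreducible p) (hodd : Odd p.natDegree)
    (hx : aeval x p = 0) (hy : aeval y p = 0) {r s : K}
    (hxy : y = algebraMap K L r + algebraMap K L s * x) : y = x := by
  have : Fact (Irreducible p) := ⟨hp⟩
  have := Module.Finite.of_basis (AdjoinRoot.powerBasis hp.ne_zero).basis
  have hfinrank : Module.finrank K (AdjoinRoot p) = p.natDegree :=
    (AdjoinRoot.powerBasis hp.ne_zero).finrank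
  let ι : AdjoinRoot p →ₐ[K] L := AdjoinRoot.liftAlgHom p (Algebra.ofId K L) x hx
  set a := AdjoinRoot.root p
  have hιa : ι a = x := AdjoinRoot.liftAlgHom_root ..
  set b := algebraMap K (AdjoinRoot p) r + algebraMap K (AdjoinRoot p) s * a
  have hιb : ι b = y := by
    simp only [b, map_add, map_mul, AlgHom.commutes, hιa, hxy]
  have hb : aeval b p = 0 := by
    rw [← map_eq_zero ι, ← aeval_algHom_apply, hιb, hy]
  let φ : AdjoinRoot p →ₐ[K] AdjoinRoot p := AdjoinRoot.liftAlgHom p (Algebra.ofId K _) b hb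
  have hφ : φ a = b := AdjoinRoot.liftAlgHom_root ..
  have hba : AlgEquiv.ofBijective φ (AlgHom.bijective φ) a = a :=
    algEquiv_apply_eq_self_of_eq_add_mul (hfinrank ▸ hodd) _ hφ
  rw [← hιa, ← hιb, ← hφ]
  exact congrArg ι hba

theorem linearIndependent_one_of_irreducible_of_odd (hp : Irreducible p) (hodd : Odd p.natDegree)
    (hdeg : p.natDegree ≠ 1) (hx : aeval x p = 0) (hy : aeval y p = 0) (hxy : x ≠ y) :
    LinearIndependent K ![1, x, y] := by
  have hpair : LinearIndependent K ![1, x] := by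
    refine (LinearIndependent.pair_iff' one_ne_zero).2 fun c hc => hdeg ?_
    have hroot : p.IsRoot c := by
      rw [← hc, ← Algebra.algebraMap_eq_smul_one, aeval_algebraMap_apply] at hx
      exact (map_eq_zero _).1 hx
    exact natDegree_eq_of_degree_eq_some (degree_eq_one_of_irreducible_of_root hp hroot)
  have hspan : y ∉ Submodule.span K {1, x} := by
    rw [Submodule.mem_span_pair]
    rintro ⟨r, s, rfl⟩
    exact hxy.symm (eq_of_aeval_eq_zero_of_eq_add_mul hp hodd hx hy (r := r) (s := s)
      (by simp only [Algebra.smul_def, mul_one]))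
  have hsnoc : ![1, x, y] = Fin.snoc ![1, x] y := by
    ext i
    fin_cases i <;> rfl
  rw [hsnoc, linearIndependent_finSnoc]
  exact ⟨hpair, by simpa [Set.pair_comm] using hspan⟩

end OddDegree

section Cubic

open Polynomial

/-- The characteristic polynomial `X ^ 3 - X ^ 2 - (l + 1) X + 1` of the quotient of the adjacency
matrix of `T_{l,l}` by the equitable partition into coalescence, middle and pendant vertices. -/
def quotientCubic (l : ℕ) : Cubic ℚ := ⟨1, -1, -(l + 1), 1⟩

theorem natDegree_quotientCubic (l : ℕ) : (quotientCubic l).toPoly.natDegree = 3 :=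
  Cubic.natDegree_of_a_ne_zero one_ne_zero

theorem aeval_quotientCubic {A : Type*} [Ring A] [Algebra ℚ A] (l : ℕ) (x : A) :
    aeval x (quotientCubic l).toPoly = x ^ 3 - x ^ 2 - (l + 1) * x + 1 := by
  simp only [quotientCubic, Cubic.toPoly, map_add, map_mul, map_pow, aeval_X, map_one,
    map_neg, map_natCast]
  noncomm_ring

theorem irreducible_quotientCubic {l : ℕ} (hl : l ≠ 0) : Irreducible (quotientCubic l).toPoly := by
  refine irreducible_of_degree_le_three_of_not_isRoot (by simp [natDegree_quotientCubic])
    fun r hr => ?_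
  rw [IsRoot, ← coe_aeval_eq_eval, aeval_quotientCubic] at hr
  have hmonic : (X ^ 3 - X ^ 2 - (l + 1 : ℤ[X]) * X + 1).Monic := by monicity!
  obtain ⟨n, rfl⟩ := isInteger_of_is_root_of_monic (K := ℚ) (r := r) hmonic (by simpa using hr)
  rw [algebraMap_int_eq, eq_intCast] at hr
  have hn : n ^ 3 - n ^ 2 - (l + 1) * n + 1 = 0 := by exact_mod_cast hr
  have hunit : IsUnit n := .of_mul_eq_one (-(n ^ 2 - n - (l + 1))) (by linear_combination -hn)
  rcases Int.isUnit_iff.1 hunit with rfl | rfl <;> norm_num at hn <;> omega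

theorem splits_quotientCubic (l : ℕ) :
    ((quotientCubic l).toPoly.map (algebraMap ℚ ℝ)).Splits := by
  let B : Matrix (Fin 3) (Fin 3) ℝ := !![1, √l, 0; √l, 0, 1; 0, 1, 0]
  have hB : B.IsHermitian := by
    ext i j
    fin_cases i <;> fin_cases j <;> rfl
  have hsqrt : (C √(l : ℝ)) ^ 2 = (l : ℝ[X]) := by
    rw [← C_pow, Real.sq_sqrt l.cast_nonneg, map_natCast]
  have hcharpoly : (quotientCubic l).toPoly.map (algebraMap ℚ ℝ) = B.charpoly := by
    have hcharmatrix : B.charmatrix =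
        !![X - 1, -C √(l : ℝ), 0; -C √(l : ℝ), X, -1; 0, -1, X] := by
      ext1 i j
      fin_cases i <;> fin_cases j <;> simp [B, Matrix.charmatrix]
    rw [Matrix.charpoly, hcharmatrix, Matrix.det_fin_three, quotientCubic, Cubic.toPoly]
    simp only [map_one, map_neg, map_add, map_natCast, Polynomial.map_add, Polynomial.map_mul,
      Polynomial.map_pow, Polynomial.map_neg, Polynomial.map_one, Polynomial.map_natCast, map_X,
      Matrix.of_apply, Matrix.cons_val]
    linear_combination X * hsqrt
  rw [hcharpoly]
  exact hB.splits_charpoly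

theorem exists_roots_quotientCubic {l : ℕ} (hl : l ≠ 0) : ∃ x y z : ℝ, x ≠ y ∧ x + y + z = 1 ∧
    (quotientCubic l).toPoly.aroots ℝ = {x, y, z} := by
  have ha : (quotientCubic l).a ≠ 0 := one_ne_zero
  obtain ⟨x, y, z, h⟩ := (Cubic.splits_iff_roots_eq_three ha).1 (splits_quotientCubic l)
  have hsum := Cubic.b_eq_three_roots ha h
  rw [Cubic.map_roots] at h
  have hnodup : ({x, y, z} : Multiset ℝ).Nodup :=
    h ▸ nodup_roots (irreducible_quotientCubic hl).separable.map
  refine ⟨x, y, z, ?_, ?_, h⟩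
  · rintro rfl
    simp at hnodup
  · simp only [quotientCubic, map_neg, map_one, one_mul] at hsum
    linarith

end Cubic

section TransferTimes

/-- The times `(4ℤ - 1) π / 2` along which the transfer happens. -/
def transferTimes : Set ℝ := {t | ∃ q : ℤ, t = (4 * (q : ℝ) - 1) * (Real.pi / 2)}

theorem exp_I_mul_of_mem_transferTimes {t : ℝ} (ht : t ∈ transferTimes) :
    Complex.exp (Complex.I * t) = -Complex.I := by
  obtain ⟨q, rfl⟩ := ht
  have h : Complex.I * ((4 * (q : ℝ) - 1) * (Real.pi / 2) : ℝ) =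
      -(Real.pi / 2 * Complex.I) + q * (2 * Real.pi * Complex.I) := by
    push_cast
    ring
  rw [h, Complex.exp_add, Complex.exp_int_mul_two_pi_mul_I, mul_one, Complex.exp_neg,
    Complex.exp_pi_div_two_mul_I, Complex.inv_I]

theorem exists_transferTimes_tendsto_exp_I_of_linearIndependent {n : ℕ} {α : Fin n → ℝ}
    (hα : LinearIndependent ℚ (Fin.cons 1 α : Fin (n + 1) → ℝ)) :
    ∃ τ : ℕ → ℝ, (∀ k, τ k ∈ transferTimes) ∧
      ∀ i, Tendsto (fun k => Complex.exp (Complex.I * τ k * α i)) atTop (𝓝 Complex.I) := by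
  obtain ⟨q, hq⟩ := exists_seq_tendsto_exp_of_linearIndependent hα fun i => (α i + 1) / 4
  refine ⟨fun k => (4 * (q k : ℤ) - 1) * (Real.pi / 2), fun k => ⟨q k, rfl⟩, fun i => ?_⟩
  have h := (hq i).mul_const (Complex.exp (-(Real.pi / 2 * Complex.I * α i)))
  have hI : Complex.exp (2 * Real.pi * Complex.I * ((α i + 1) / 4 : ℝ)) *
      Complex.exp (-(Real.pi / 2 * Complex.I * α i)) = Complex.I := by
    rw [← Complex.exp_add]
    conv_rhs => rw [← Complex.exp_pi_div_two_mul_I]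
    push_cast
    ring_nf
  rw [hI] at h
  refine h.congr fun k => ?_
  rw [← Complex.exp_add]
  push_cast
  ring_nf

theorem tendsto_exp_I_of_add_add_eq_one {τ : ℕ → ℝ} (hτ : ∀ k, τ k ∈ transferTimes) {x y z : ℝ}
    (hsum : x + y + z = 1)
    (hx : Tendsto (fun k => Complex.exp (Complex.I * τ k * x)) atTop (𝓝 Complex.I))
    (hy : Tendsto (fun k => Complex.exp (Complex.I * τ k * y)) atTop (𝓝 Complex.I)) :
    Tendsto (fun k => Complex.exp (Complex.I * τ k * z)) atTop (𝓝 Complex.I) := by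
  have h := ((hx.mul hy).inv₀ (by simp)).const_mul (-Complex.I)
  rw [Complex.I_mul_I, inv_neg, inv_one, mul_neg, mul_one, neg_neg] at h
  refine h.congr fun k => ?_
  rw [← exp_I_mul_of_mem_transferTimes (hτ k), ← Complex.exp_add, ← Complex.exp_neg,
    ← Complex.exp_add, ← sub_eq_of_eq_add' hsum.symm]
  push_cast
  ring_nf

theorem exists_transferTimes_tendsto_exp_I_of_mem_aroots {l : ℕ} (hl : l ≠ 0) :
    ∃ τ : ℕ → ℝ, (∀ k, τ k ∈ transferTimes) ∧ ∀ μ ∈ (quotientCubic l).toPoly.aroots ℂ,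
      Tendsto (fun k => Complex.exp (Complex.I * τ k * μ)) atTop (𝓝 Complex.I) := by
  obtain ⟨x, y, z, hxy, hsum, hroots⟩ := exists_roots_quotientCubic hl
  have hroot {w : ℝ} (hw : w ∈ ({x, y, z} : Multiset ℝ)) :
      Polynomial.aeval w (quotientCubic l).toPoly = 0 :=
    (Polynomial.mem_aroots.1 (hroots ▸ hw)).2
  have hind : LinearIndependent ℚ ![1, x, y] :=
    linearIndependent_one_of_irreducible_of_odd (irreducible_quotientCubic hl)
      (by rw [natDegree_quotientCubic]; decide) (by simp [natDegree_quotientCubic])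
      (hroot (by simp)) (hroot (by simp)) hxy
  obtain ⟨τ, hτ, hlim⟩ :=
    exists_transferTimes_tendsto_exp_I_of_linearIndependent (α := ![x, y]) hind
  have hx : Tendsto (fun k => Complex.exp (Complex.I * τ k * x)) atTop (𝓝 Complex.I) := hlim 0
  have hy : Tendsto (fun k => Complex.exp (Complex.I * τ k * y)) atTop (𝓝 Complex.I) := hlim 1
  have hz := tendsto_exp_I_of_add_add_eq_one hτ hsum hx hy
  have hroots_complex : (quotientCubic l).toPoly.aroots ℂ = {(x : ℂ), (y : ℂ), (z : ℂ)} := by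
    rw [Polynomial.aroots, IsScalarTower.algebraMap_eq ℚ ℝ ℂ, ← Polynomial.map_map,
      (splits_quotientCubic l).roots_map, ← Polynomial.aroots, hroots]
    rfl
  refine ⟨τ, hτ, ?_⟩
  simpa [hroots_complex] using ⟨hx, hy, hz⟩

end TransferTimes

section SpectralDecomposition

open Polynomial Module.End

theorem ker_aeval_prod_X_sub_C {K M : Type*} [Field K] [AddCommGroup M] [Module K M]
    (f : Module.End K M) (s : Finset K) :
    LinearMap.ker (aeval f (∏ μ ∈ s, (X - C μ))) = ⨆ μ ∈ s, eigenspace f μ := by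
  classical
  induction s using Finset.induction_on with
  | empty => simp [one_eq_id]
  | insert μ s hμ ih =>
    have hcoprime : IsCoprime (X - C μ) (∏ ν ∈ s, (X - C ν)) :=
      IsCoprime.prod_right fun ν hν => isCoprime_X_sub_C_of_isUnit_sub
        (sub_ne_zero.2 (ne_of_mem_of_not_mem hν hμ).symm).isUnit
    rw [Finset.prod_insert hμ, ← sup_ker_aeval_eq_ker_aeval_mul_of_coprime f hcoprime, ih,
      Finset.iSup_insert]
    simp [eigenspace_def, Algebra.algebraMap_eq_smul_one]

theorem ker_aeval_eq_iSup_eigenspace {K M : Type*} [Field K] [AddCommGroup M] [Module K M]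
    (f : Module.End K M) {p : K[X]} (hsep : p.Separable) (hsplits : p.Splits) :
    LinearMap.ker (aeval f p) = ⨆ μ ∈ p.roots, eigenspace f μ := by
  have hprod :
      C p.leadingCoeff * ∏ μ ∈ (⟨p.roots, nodup_roots hsep⟩ : Finset K), (X - C μ) = p := by
    rw [Finset.prod_mk, ← hsplits.eq_prod_roots]
  have hlead : p.leadingCoeff ≠ 0 := leadingCoeff_ne_zero.2 hsep.ne_zero
  trans LinearMap.ker (aeval f (∏ μ ∈ (⟨p.roots, nodup_roots hsep⟩ : Finset K), (X - C μ)))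
  · ext v
    conv_lhs => rw [← hprod]
    simp only [LinearMap.mem_ker, map_mul, aeval_C, Module.End.mul_apply,
      Module.algebraMap_end_apply, smul_eq_zero_iff_right hlead]
  · rw [ker_aeval_prod_X_sub_C]
    rfl

variable {V : Type*} [Fintype V] [DecidableEq V]

open scoped Matrix.Norms.Operator in
theorem exp_smul_mulVec_of_eigenvector {A : Matrix V V ℂ} {v : V → ℂ} {μ : ℂ}
    (h : A.mulVec v = μ • v) (c : ℂ) :
    (NormedSpace.exp (c • A)).mulVec v = Complex.exp (c * μ) • v := by
  have hpow : ∀ n : ℕ, ((c • A) ^ n).mulVec v = (c * μ) ^ n • v := fun n => by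
    induction n with
    | zero => simp
    | succ n ih =>
      rw [pow_succ, ← Matrix.mulVec_mulVec, Matrix.smul_mulVec, h, smul_smul, Matrix.mulVec_smul,
        ih, smul_smul, pow_succ, mul_comm]
  have hmatrix := (NormedSpace.exp_series_hasSum_exp' (𝕂 := ℂ) (c • A)).map
    (Matrix.mulVec.addMonoidHomLeft v) (continuous_id.matrix_mulVec continuous_const)
  have hscalar := (NormedSpace.exp_series_hasSum_exp' (𝕂 := ℂ) (c * μ)).smul_const v
  rw [← Complex.exp_eq_exp_ℂ] at hscalar
  refine hmatrix.unique (hscalar.congr_fun fun n => ?_)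
  simp [Matrix.mulVec.addMonoidHomLeft, Matrix.smul_mulVec, hpow, smul_smul]

theorem tendsto_exp_smul_mulVec {A : Matrix V V ℂ} {p : ℂ[X]} (hp : p.Separable) {v : V → ℂ}
    (hv : (aeval A p).mulVec v = 0) {c : ℕ → ℂ} {γ : ℂ}
    (hc : ∀ μ ∈ p.roots, Tendsto (fun k => Complex.exp (c k * μ)) atTop (𝓝 γ)) :
    Tendsto (fun k => (NormedSpace.exp (c k • A)).mulVec v) atTop (𝓝 (γ • v)) := by
  have hmem : v ∈ ⨆ μ ∈ p.roots, eigenspace (Matrix.toLinAlgEquiv' A) μ := by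
    rw [← ker_aeval_eq_iSup_eigenspace _ hp (IsAlgClosed.splits p), LinearMap.mem_ker,
      ← AlgEquiv.coe_toAlgHom, aeval_algHom_apply]
    exact hv
  clear hv
  rw [iSup_subtype'] at hmem
  induction hmem using Submodule.iSup_induction' with
  | mem μ w hw =>
    have hw' : A.mulVec w = (μ : ℂ) • w := mem_eigenspace_iff.1 hw
    simp_rw [exp_smul_mulVec_of_eigenvector hw']
    exact (hc μ μ.2).smul_const w
  | zero => simp
  | add v w _ _ hv hw => simpa [Matrix.mulVec_add] using hv.add hw

end SpectralDecomposition

section Bipartite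

variable {V : Type*} [Fintype V] [DecidableEq V] {G : SimpleGraph V}

/-- The diagonal matrix of signs that tells apart the two colour classes of a bipartite graph. -/
noncomputable def signMatrix (c : G.Coloring Bool) : Matrix V V ℂ :=
  Matrix.diagonal fun v => bif c v then 1 else -1

theorem signMatrix_mul_self (c : G.Coloring Bool) : signMatrix c * signMatrix c = 1 := by
  rw [signMatrix, Matrix.diagonal_mul_diagonal, ← Matrix.diagonal_one]
  congr 1
  ext v
  cases c v <;> simp

theorem signMatrix_mulVec_single (c : G.Coloring Bool) (v : V) :
    (signMatrix c).mulVec (Pi.single v 1) = (bif c v then (1 : ℂ) else -1) • Pi.single v 1 := by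
  rw [signMatrix, Matrix.diagonal_mulVec_single, ← Pi.single_smul, smul_eq_mul]

theorem signMatrix_mul_adjMatrix_mul_signMatrix [DecidableRel G.Adj] (c : G.Coloring Bool) :
    signMatrix c * G.adjMatrix ℂ * signMatrix c = -G.adjMatrix ℂ := by
  ext u v
  rw [signMatrix, Matrix.mul_diagonal, Matrix.diagonal_mul, Matrix.neg_apply,
    SimpleGraph.adjMatrix_apply]
  by_cases h : G.Adj u v
  · have := c.valid h
    cases hu : c u <;> cases hv : c v <;> simp_all
  · simp [h]

theorem transitionMatrix_mul_signMatrix (c : G.Coloring Bool) (t : ℝ) :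
    transitionMatrix G t * signMatrix c = signMatrix c * transitionMatrix G (-t) := by
  classical
  have hinv : (signMatrix c)⁻¹ = signMatrix c := Matrix.inv_eq_left_inv (signMatrix_mul_self c)
  have hconj := Matrix.exp_conj (signMatrix c) ((Complex.I * t) • G.adjMatrix ℂ)
    (.of_mul_eq_one _ (signMatrix_mul_self c))
  rw [hinv, Matrix.mul_smul, Matrix.smul_mul, signMatrix_mul_adjMatrix_mul_signMatrix,
    smul_neg, ← neg_smul, ← mul_neg, ← Complex.ofReal_neg] at hconj
  rw [transitionMatrix, transitionMatrix, hconj, ← mul_assoc, ← mul_assoc, signMatrix_mul_self,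
    one_mul]

open Classical in
theorem tendsto_transitionMatrix_mulVec_signMatrix_mulVec (c : G.Coloring Bool)
    {p : Polynomial ℂ} (hp : p.Separable) {v : V → ℂ}
    (hv : (Polynomial.aeval (G.adjMatrix ℂ) p).mulVec v = 0) {τ : ℕ → ℝ} {γ : ℂ} (hγ : γ ≠ 0)
    (hlim : ∀ μ ∈ p.roots, Tendsto (fun k => Complex.exp (Complex.I * τ k * μ)) atTop (𝓝 γ)) :
    Tendsto (fun k => (transitionMatrix G (τ k)).mulVec ((signMatrix c).mulVec v)) atTop
      (𝓝 (γ⁻¹ • (signMatrix c).mulVec v)) := by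
  have hlim_neg : ∀ μ ∈ p.roots,
      Tendsto (fun k => Complex.exp (Complex.I * ↑(-τ k) * μ)) atTop (𝓝 γ⁻¹) := fun μ hμ => by
    simpa [Complex.exp_neg] using (hlim μ hμ).inv₀ hγ
  simp_rw [Matrix.mulVec_mulVec, transitionMatrix_mul_signMatrix, ← Matrix.mulVec_mulVec,
    ← Matrix.mulVec_smul]
  exact ((continuous_const.matrix_mulVec continuous_id).tendsto _).comp
    (tendsto_exp_smul_mulVec hp hv hlim_neg)

open Classical in
theorem prettyGoodStateTransferIn_of_coloring (c : G.Coloring Bool) {a b : V} (hab : c a ≠ c b)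
    {p : Polynomial ℂ} (hp : p.Separable)
    (hker : (Polynomial.aeval (G.adjMatrix ℂ) p).mulVec (Pi.single a 1 + Pi.single b 1) = 0)
    {S : Set ℝ} {τ : ℕ → ℝ} (hτ : ∀ k, τ k ∈ S) {γ : ℂ} (hγ : γ ^ 2 = -1)
    (hlim : ∀ μ ∈ p.roots, Tendsto (fun k => Complex.exp (Complex.I * τ k * μ)) atTop (𝓝 γ)) :
    PrettyGoodStateTransferIn G a b S := by
  refine ⟨fun h => hab (h ▸ rfl), τ, γ, hτ, ?_⟩
  set s : V → ℂ := Pi.single a 1 + Pi.single b 1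
  have hγ0 : γ ≠ 0 := by
    rintro rfl
    norm_num at hγ
  have hγinv : γ⁻¹ = -γ := inv_eq_of_mul_eq_one_right (by linear_combination -hγ)
  have hsymm : Tendsto (fun k => (transitionMatrix G (τ k)).mulVec s) atTop (𝓝 (γ • s)) :=
    tendsto_exp_smul_mulVec hp hker hlim
  have hanti := tendsto_transitionMatrix_mulVec_signMatrix_mulVec c hp hker hγ0 hlim
  obtain ⟨ε, hε⟩ : ∃ ε : ℂ, ε • (signMatrix c).mulVec s = Pi.single a 1 - Pi.single b 1 := by
    refine ⟨bif c a then 1 else -1, ?_⟩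
    rw [Matrix.mulVec_add, signMatrix_mulVec_single, signMatrix_mulVec_single,
      Bool.eq_not.2 hab.symm]
    cases c a <;> simp [sub_eq_add_neg]
  have ha : (Pi.single a 1 : V → ℂ) = (1 / 2 : ℂ) • (s + ε • (signMatrix c).mulVec s) := by
    rw [hε]
    module
  have hb : γ • (Pi.single b 1 : V → ℂ) =
      (1 / 2 : ℂ) • (γ • s + ε • γ⁻¹ • (signMatrix c).mulVec s) := by
    rw [hγinv, smul_comm ε, hε]
    module
  rw [ha, hb]
  simp_rw [Matrix.mulVec_smul, Matrix.mulVec_add, Matrix.mulVec_smul]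
  exact (hsymm.add (hanti.const_smul ε)).const_smul _

end Bipartite

section DoubleStar

variable {l m : ℕ}

theorem subdividedStar_adj_none_some {i : Fin l} {j : Fin 2} :
    (subdividedStar l).Adj none (some (i, j)) ↔ j = 0 := by
  simp [subdividedStar, eq_comm]

theorem subdividedStar_adj_some_none {i : Fin l} {j : Fin 2} :
    (subdividedStar l).Adj (some (i, j)) none ↔ j = 0 := by
  rw [SimpleGraph.adj_comm, subdividedStar_adj_none_some]

theorem subdividedStar_adj_some_some {i i' : Fin l} {j j' : Fin 2} :
    (subdividedStar l).Adj (some (i, j)) (some (i', j')) ↔ i = i' ∧ j ≠ j' := by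
  fin_cases j <;> fin_cases j' <;> simp [subdividedStar, eq_comm]

theorem doubleSubdividedStar_adj_inl_inl {u v : Option (Fin l × Fin 2)} :
    (doubleSubdividedStar l m).Adj (Sum.inl u) (Sum.inl v) ↔ (subdividedStar l).Adj u v := by
  simp [doubleSubdividedStar, SimpleGraph.edge_adj, coalescenceLeft, coalescenceRight]

theorem doubleSubdividedStar_adj_inr_inr {u v : Option (Fin m × Fin 2)} :
    (doubleSubdividedStar l m).Adj (Sum.inr u) (Sum.inr v) ↔ (subdividedStar m).Adj u v := by
  simp [doubleSubdividedStar, SimpleGraph.edge_adj, coalescenceLeft, coalescenceRight]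

theorem doubleSubdividedStar_adj_inl_inr {u : Option (Fin l × Fin 2)}
    {v : Option (Fin m × Fin 2)} :
    (doubleSubdividedStar l m).Adj (Sum.inl u) (Sum.inr v) ↔ u = none ∧ v = none := by
  simp [doubleSubdividedStar, SimpleGraph.edge_adj, coalescenceLeft, coalescenceRight]

theorem doubleSubdividedStar_adj_inr_inl {u : Option (Fin l × Fin 2)}
    {v : Option (Fin m × Fin 2)} :
    (doubleSubdividedStar l m).Adj (Sum.inr v) (Sum.inl u) ↔ u = none ∧ v = none := by
  rw [SimpleGraph.adj_comm, doubleSubdividedStar_adj_inl_inr]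

/-- The proper two-colouring of a subdivided star in which the middle vertices form one class. -/
def subdividedStarColoring (l : ℕ) : (subdividedStar l).Coloring Bool :=
  SimpleGraph.Coloring.mk (fun v => v.elim true fun p => p.2 = 1) <| by
    rintro (_ | ⟨i, j⟩) (_ | ⟨i', j'⟩) h
    · exact absurd h (SimpleGraph.irrefl _)
    · simp [subdividedStar_adj_none_some.1 h]
    · simp [subdividedStar_adj_some_none.1 h]
    · have hne := (subdividedStar_adj_some_some.1 h).2
      simp only [Option.elim_some, ne_eq, decide_eq_decide]
      omega

/-- The proper two-colouring of the double subdivided star in which the coalescence vertices have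
different colours. -/
def doubleSubdividedStarColoring (l m : ℕ) : (doubleSubdividedStar l m).Coloring Bool :=
  SimpleGraph.Coloring.mk
    (Sum.elim (subdividedStarColoring l) fun v => !subdividedStarColoring m v) <| by
    rintro (u | u) (v | v) h
    · exact (subdividedStarColoring l).valid (doubleSubdividedStar_adj_inl_inl.1 h)
    · obtain ⟨rfl, rfl⟩ := doubleSubdividedStar_adj_inl_inr.1 h
      exact Bool.noConfusion
    · obtain ⟨rfl, rfl⟩ := doubleSubdividedStar_adj_inr_inl.1 h
      exact Bool.noConfusion
    · simpa using (subdividedStarColoring m).valid (doubleSubdividedStar_adj_inr_inr.1 h)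

theorem doubleSubdividedStarColoring_coalescenceLeft_ne (l m : ℕ) :
    doubleSubdividedStarColoring l m (coalescenceLeft l m) ≠
      doubleSubdividedStarColoring l m (coalescenceRight l m) :=
  Bool.noConfusion

/-- The cells of an equitable partition of `T_{l,l}`, numbered by the distance to the nearest
coalescence vertex. -/
def layer (l : ℕ) : DoubleStarVertex l l → Fin 3 :=
  let f : Option (Fin l × Fin 2) → Fin 3 := fun v => v.elim 0 fun p => p.2.succ
  Sum.elim f f

theorem single_add_single_eq_comp_layer (l : ℕ) :
    Pi.single (coalescenceLeft l l) 1 + Pi.single (coalescenceRight l l) 1 =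
      (![1, 0, 0] ∘ layer l : DoubleStarVertex l l → ℂ) := by
  funext u
  rcases u with (_ | ⟨i, j⟩) | (_ | ⟨i, j⟩)
  · simp [layer, coalescenceLeft, coalescenceRight]
  · fin_cases j <;> simp [layer, coalescenceLeft, coalescenceRight]
  · simp [layer, coalescenceLeft, coalescenceRight]
  · fin_cases j <;> simp [layer, coalescenceLeft, coalescenceRight]

theorem adjMatrix_mulVec_comp_layer [DecidableRel (doubleSubdividedStar l l).Adj] (x y z : ℂ) :
    ((doubleSubdividedStar l l).adjMatrix ℂ).mulVec (![x, y, z] ∘ layer l) =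
      ![x + l * y, x + z, y] ∘ layer l := by
  funext u
  simp only [Matrix.mulVec, dotProduct, SimpleGraph.adjMatrix_apply, Fintype.sum_sum_type,
    Fintype.sum_option, Fintype.sum_prod_type, Fin.sum_univ_two]
  rcases u with (_ | ⟨i, j⟩) | (_ | ⟨i, j⟩)
  · simp [doubleSubdividedStar_adj_inl_inl, doubleSubdividedStar_adj_inl_inr,
      subdividedStar_adj_none_some, layer, add_comm]
  · fin_cases j <;>
    simp [doubleSubdividedStar_adj_inl_inl, doubleSubdividedStar_adj_inl_inr,
      subdividedStar_adj_some_some, subdividedStar_adj_some_none, layer]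
  · simp [doubleSubdividedStar_adj_inr_inr, doubleSubdividedStar_adj_inr_inl,
      subdividedStar_adj_none_some, layer]
  · fin_cases j <;>
    simp [doubleSubdividedStar_adj_inr_inr, doubleSubdividedStar_adj_inr_inl,
      subdividedStar_adj_some_some, subdividedStar_adj_some_none, layer]

theorem aeval_quotientCubic_adjMatrix_mulVec_single_add_single
    [DecidableRel (doubleSubdividedStar l l).Adj] :
    (Polynomial.aeval ((doubleSubdividedStar l l).adjMatrix ℂ) (quotientCubic l).toPoly).mulVec
      (Pi.single (coalescenceLeft l l) 1 + Pi.single (coalescenceRight l l) 1) = 0 := by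
  have hexpand (A : Matrix (DoubleStarVertex l l) (DoubleStarVertex l l) ℂ) (v) :
      (A ^ 3 - A ^ 2 - (l + 1) * A + 1).mulVec v =
        A.mulVec (A.mulVec (A.mulVec v)) - A.mulVec (A.mulVec v) -
          (l + 1 : ℂ) • A.mulVec v + v := by
    simp [Matrix.add_mulVec, Matrix.sub_mulVec, add_mul, pow_succ, add_smul,
      ← Matrix.mulVec_mulVec]
  rw [aeval_quotientCubic, hexpand, single_add_single_eq_comp_layer]
  simp only [adjMatrix_mulVec_comp_layer]
  funext u
  simp only [Pi.add_apply, Pi.sub_apply, Pi.smul_apply, Function.comp_apply, Pi.zero_apply]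
  generalize layer l u = i
  fin_cases i
  · simp only [Fin.zero_eta, Matrix.cons_val_zero, smul_eq_mul]
    ring
  · simp only [Fin.mk_one, Matrix.cons_val_one, Matrix.cons_val_zero, smul_eq_mul]
    ring
  · simp

theorem adjMatrix_zero_mulVec_single_add_single [DecidableRel (doubleSubdividedStar 0 0).Adj] :
    ((doubleSubdividedStar 0 0).adjMatrix ℂ).mulVec
      (Pi.single (coalescenceLeft 0 0) 1 + Pi.single (coalescenceRight 0 0) 1) =
      Pi.single (coalescenceLeft 0 0) 1 + Pi.single (coalescenceRight 0 0) 1 := by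
  rw [single_add_single_eq_comp_layer, adjMatrix_mulVec_comp_layer]
  funext u
  rcases u with (_ | ⟨i, j⟩) | (_ | ⟨i, j⟩)
  · simp [layer]
  · exact i.elim0
  · simp [layer]
  · exact i.elim0

theorem prettyGoodStateTransferIn_doubleSubdividedStar_zero :
    PrettyGoodStateTransferIn (doubleSubdividedStar 0 0)
      (coalescenceLeft 0 0) (coalescenceRight 0 0) transferTimes := by
  classical
  have hmem : (4 * ((0 : ℤ) : ℝ) - 1) * (Real.pi / 2) ∈ transferTimes := ⟨0, rfl⟩
  refine prettyGoodStateTransferIn_of_coloring (doubleSubdividedStarColoring 0 0)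
    (doubleSubdividedStarColoring_coalescenceLeft_ne 0 0)
    (Polynomial.separable_X_sub_C (x := 1)) ?_ (fun _ => hmem)
    (γ := -Complex.I) (by simp) fun μ hμ => ?_
  · rw [map_sub, Polynomial.aeval_X, Polynomial.aeval_C, map_one, Matrix.sub_mulVec,
      Matrix.one_mulVec, adjMatrix_zero_mulVec_single_add_single, sub_self]
  · rw [Polynomial.roots_X_sub_C, Multiset.mem_singleton] at hμ
    simp_rw [hμ, mul_one, exp_I_mul_of_mem_transferTimes hmem]
    exact tendsto_const_nhds

theorem prettyGoodStateTransferIn_doubleSubdividedStar_of_ne_zero (hl : l ≠ 0) :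
    PrettyGoodStateTransferIn (doubleSubdividedStar l l)
      (coalescenceLeft l l) (coalescenceRight l l) transferTimes := by
  classical
  obtain ⟨τ, hτ, hlim⟩ := exists_transferTimes_tendsto_exp_I_of_mem_aroots hl
  refine prettyGoodStateTransferIn_of_coloring (doubleSubdividedStarColoring l l)
    (doubleSubdividedStarColoring_coalescenceLeft_ne l l)
    (irreducible_quotientCubic hl).separable.map ?_ hτ Complex.I_sq hlim
  rw [Polynomial.aeval_map_algebraMap]
  exact aeval_quotientCubic_adjMatrix_mulVec_single_add_single

end DoubleStar

theorem theorem3p2 (l : ℕ) :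
    PrettyGoodStateTransferIn (doubleSubdividedStar l l)
      (coalescenceLeft l l) (coalescenceRight l l)
      {t : ℝ | ∃ q : ℤ, t = (4 * (q : ℝ) - 1) * (Real.pi / 2)} := by
  rcases eq_or_ne l 0 with rfl | hl
  · exact prettyGoodStateTransferIn_doubleSubdividedStar_zero
  · exact prettyGoodStateTransferIn_doubleSubdividedStar_of_ne_zero hl
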